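/- Let $M$ be a smooth finite-dimensional manifold with a smooth pseudo-Riemannian metric $g$ (of arbitrary signature), and let $\nabla$ be its Levi-Civita connection. A \emph{homothetic Killing vector} of $(M,g)$ is a smooth vector field $\xi$ on $M$ such that $$\nabla_\mu \xi_\nu+\nabla_\nu\xi_\mu=\lambda\, g_{\mu\nu}$$ for some constant $\lambda\in\mathbb R$ (possibly zero); it is a \emph{true Killing vector} if this holds with $\lambda=0$. Homothetic Killing vectors form a real vector space. 1. If $\xi$ and $\eta$ are homothetic Killing vectors, then their Lie bracket $[\xi,\eta]^\mu=\xi^\nu\nabla_\nu\eta^\mu-\eta^\nu\nabla_\nu\xi^\mu$ is a true Killing vector. 2. Consequently, let $(\xi_{(k)})_k$ be a basis of the space of homothetic Killing vectors, with $\nabla_\mu \xi_{(k)\nu}+\nabla_\nu\xi_{(k)\mu}=\lambda_{(k)}\, g_{\mu\nu}$. Then there are unique structure constants ${c_{ij}}^k\in\mathbb R$ (for fixed $i,j$ only finitely many nonzero) with $[\xi_{(i)},\xi_{(j)}]=\sum_k {c_{ij}}^k\,\xi_{(k)}$, and they satisfy $$\sum_k {c_{ij}}^k\,\lambda_{(k)}=0\qquad\text{for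 all } i,j.$$ -/

import Mathlib

open scoped Manifold ContDiff Bundle
open Bundle VectorField

noncomputable section

/-- A smooth pseudo-Riemannian metric (of arbitrary signature) on a manifold `M` modelled on `E`:
a smooth field `g` of symmetric, nondegenerate bilinear forms on the tangent spaces. -/
structure PseudoRiemannianMetric (E : Type*) [NormedAddCommGroup E] [NormedSpace ℝ E]
    (M : Type*) [TopologicalSpace M] [ChartedSpace E M] [IsManifold 𝓘(ℝ, E) ∞ M] where
  /-- The bilinear form `g x` on the tangent space at `x`. -/
  val (x : M) : TangentSpace 𝓘(ℝ, E) x →L[ℝ] TangentSpace 𝓘(ℝ, E) x →L[ℝ] ℝ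
  symm (x : M) (v w : TangentSpace 𝓘(ℝ, E) x) : val x v w = val x w v
  nondegenerate (x : M) (v : TangentSpace 𝓘(ℝ, E) x) (hv : ∀ w, val x v w = 0) : v = 0
  contMDiff : ContMDiff 𝓘(ℝ, E) (𝓘(ℝ, E).prod 𝓘(ℝ, E →L[ℝ] E →L[ℝ] ℝ)) ∞
    (fun x ↦ TotalSpace.mk' (E →L[ℝ] E →L[ℝ] ℝ)
      (E := fun x : M ↦ TangentSpace 𝓘(ℝ, E) x →L[ℝ] TangentSpace 𝓘(ℝ, E) x →L[ℝ] ℝ) x (val x))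

namespace PseudoRiemannianMetric

variable {E : Type*} [NormedAddCommGroup E] [NormedSpace ℝ E]
  {M : Type*} [TopologicalSpace M] [ChartedSpace E M] [IsManifold 𝓘(ℝ, E) ∞ M]
  (g : PseudoRiemannianMetric E M)

/-- The function `g(Y, Z)` for vector fields `Y`, `Z`. -/
def pair (Y Z : Π x : M, TangentSpace 𝓘(ℝ, E) x) : M → ℝ := fun x ↦ g.val x (Y x) (Z x)

lemma pair_comm (Y Z : Π x : M, TangentSpace 𝓘(ℝ, E) x) : g.pair Y Z = g.pair Z Y :=
  funext fun x ↦ g.symm x _ _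

lemma pair_add_left (Y Y' Z : Π x : M, TangentSpace 𝓘(ℝ, E) x) :
    g.pair (Y + Y') Z = g.pair Y Z + g.pair Y' Z := by
  funext x; simp [pair]

lemma pair_add_right (Y Z Z' : Π x : M, TangentSpace 𝓘(ℝ, E) x) :
    g.pair Y (Z + Z') = g.pair Y Z + g.pair Y Z' := by
  funext x; simp [pair]

lemma pair_smul_left (f : M → ℝ) (Y Z : Π x : M, TangentSpace 𝓘(ℝ, E) x) :
    g.pair (f • Y) Z = f * g.pair Y Z := by
  funext x; simp [pair]

lemma pair_smul_right (f : M → ℝ) (Y Z : Π x : M, TangentSpace 𝓘(ℝ, E) x) :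
    g.pair Y (f • Z) = f * g.pair Y Z := by
  funext x; simp [pair]

lemma mdifferentiableAt_pair {Y Z : Π x : M, TangentSpace 𝓘(ℝ, E) x} {x : M}
    (hY : MDiffAt (T% Y) x) (hZ : MDiffAt (T% Z) x) : MDiffAt (g.pair Y Z) x := by
  have : MDifferentiableAt 𝓘(ℝ, E) (𝓘(ℝ, E).prod 𝓘(ℝ))
      (fun m ↦ TotalSpace.mk' ℝ (E := Bundle.Trivial M ℝ) m (g.val m (Y m) (Z m))) x := by
    apply MDifferentiableAt.clm_bundle_apply₂ (F₁ := E) (F₂ := E)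
    · exact (g.contMDiff x).mdifferentiableAt (by simp)
    · exact hY
    · exact hZ
  simp only [mdifferentiableAt_totalSpace] at this
  exact this.2

/-- The right-hand side of the Koszul formula, normalised so that it is `g(∇_X Y, Z)` for the
Levi-Civita connection `∇` of `g`. -/
def koszul (X Y Z : Π x : M, TangentSpace 𝓘(ℝ, E) x) (x : M) : ℝ :=
  (1 / 2) * (mvfderiv 𝓘(ℝ, E) (g.pair Y Z) x (X x) + mvfderiv 𝓘(ℝ, E) (g.pair X Z) x (Y x)
    - mvfderiv 𝓘(ℝ, E) (g.pair X Y) x (Z x)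
    + g.val x (mlieBracket 𝓘(ℝ, E) X Y x) (Z x)
    - g.val x (mlieBracket 𝓘(ℝ, E) X Z x) (Y x)
    - g.val x (mlieBracket 𝓘(ℝ, E) Y Z x) (X x))

lemma endo_ext {x : M} {A B : TangentSpace 𝓘(ℝ, E) x →L[ℝ] TangentSpace 𝓘(ℝ, E) x}
    (h : ∀ X Z : Π x : M, TangentSpace 𝓘(ℝ, E) x, MDiffAt (T% X) x → MDiffAt (T% Z) x →
      g.val x (A (X x)) (Z x) = g.val x (B (X x)) (Z x)) : A = B := by
  ext v
  refine sub_eq_zero.1 (g.nondegenerate x _ fun w ↦ ?_)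
  have := h (FiberBundle.extend E v) (FiberBundle.extend E w)
    (FiberBundle.mdifferentiableAt_extend ..) (FiberBundle.mdifferentiableAt_extend ..)
  simp only [FiberBundle.extend_apply_self] at this
  simp [this]

variable [FiniteDimensional ℝ E] {X Y Z : Π x : M, TangentSpace 𝓘(ℝ, E) x} {x : M}

lemma tensorialAt_koszul_left (hY : MDiffAt (T% Y) x) (hZ : MDiffAt (T% Z) x) :
    TensorialAt 𝓘(ℝ, E) E (fun X ↦ g.koszul X Y Z x) x where
  smul {f X} hf hX := by
    simp only [koszul, pair_smul_left, mvfderiv_mul hf (g.mdifferentiableAt_pair hX hZ),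
      mvfderiv_mul hf (g.mdifferentiableAt_pair hX hY), mlieBracket_smul_left hf hX]
    simp [pair]
    ring
  add {X X'} hX hX' := by
    simp only [koszul, pair_add_left, mlieBracket_add_left hX hX',
      mvfderiv_add (g.mdifferentiableAt_pair hX hZ) (g.mdifferentiableAt_pair hX' hZ),
      mvfderiv_add (g.mdifferentiableAt_pair hX hY) (g.mdifferentiableAt_pair hX' hY)]
    simp
    ring

lemma tensorialAt_koszul_right (hX : MDiffAt (T% X) x) (hY : MDiffAt (T% Y) x) :
    TensorialAt 𝓘(ℝ, E) E (fun Z ↦ g.koszul X Y Z x) x where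
  smul {f Z} hf hZ := by
    simp only [koszul, pair_smul_right, mvfderiv_mul hf (g.mdifferentiableAt_pair hX hZ),
      mvfderiv_mul hf (g.mdifferentiableAt_pair hY hZ), mlieBracket_smul_right hf hZ]
    simp [pair, g.symm x (Z x)]
    ring
  add {Z Z'} hZ hZ' := by
    simp only [koszul, pair_add_right, mlieBracket_add_right hZ hZ',
      mvfderiv_add (g.mdifferentiableAt_pair hX hZ) (g.mdifferentiableAt_pair hX hZ'),
      mvfderiv_add (g.mdifferentiableAt_pair hY hZ) (g.mdifferentiableAt_pair hY hZ')]
    simp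
    ring

lemma koszul_add (hX : MDiffAt (T% X) x) (hY : MDiffAt (T% Y) x)
    {Y' : Π x : M, TangentSpace 𝓘(ℝ, E) x} (hY' : MDiffAt (T% Y') x) (hZ : MDiffAt (T% Z) x) :
    g.koszul X (Y + Y') Z x = g.koszul X Y Z x + g.koszul X Y' Z x := by
  simp only [koszul, pair_add_left, pair_add_right, mlieBracket_add_right hY hY',
    mlieBracket_add_left hY hY',
    mvfderiv_add (g.mdifferentiableAt_pair hY hZ) (g.mdifferentiableAt_pair hY' hZ),
    mvfderiv_add (g.mdifferentiableAt_pair hX hY) (g.mdifferentiableAt_pair hX hY')]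
  simp
  ring

lemma koszul_smul (hX : MDiffAt (T% X) x) (hY : MDiffAt (T% Y) x) {f : M → ℝ} (hf : MDiffAt f x)
    (hZ : MDiffAt (T% Z) x) :
    g.koszul X (f • Y) Z x =
      f x * g.koszul X Y Z x + mvfderiv 𝓘(ℝ, E) f x (X x) * g.val x (Y x) (Z x) := by
  simp only [koszul, pair_smul_left, pair_smul_right, mlieBracket_smul_right hf hY,
    mlieBracket_smul_left hf hY, mvfderiv_mul hf (g.mdifferentiableAt_pair hY hZ),
    mvfderiv_mul hf (g.mdifferentiableAt_pair hX hY)]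
  simp [pair, g.symm x (X x) (Y x)]
  ring

/-- The isomorphism `v ↦ g(v, ·)` from vectors to covectors at `x` (lowering an index). -/
def flat (x : M) :
    TangentSpace 𝓘(ℝ, E) x ≃L[ℝ] (TangentSpace 𝓘(ℝ, E) x →L[ℝ] ℝ) :=
  haveI : FiniteDimensional ℝ (TangentSpace 𝓘(ℝ, E) x) := inferInstanceAs (FiniteDimensional ℝ E)
  haveI : T2Space (TangentSpace 𝓘(ℝ, E) x) := inferInstanceAs (T2Space E)
  haveI : FiniteDimensional ℝ (TangentSpace 𝓘(ℝ, E) x →L[ℝ] ℝ) :=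
    inferInstanceAs (FiniteDimensional ℝ (E →L[ℝ] ℝ))
  (LinearMap.linearEquivOfInjective (g.val x).toLinearMap
    ((injective_iff_map_eq_zero _).2 fun v hv ↦
      g.nondegenerate x v fun w ↦ congrArg (fun φ : TangentSpace 𝓘(ℝ, E) x →L[ℝ] ℝ ↦ φ w) hv)
    (by
      have h := (LinearMap.toContinuousLinearMap (𝕜 := ℝ) (E := E) (F' := ℝ)).finrank_eq
      exact (Subspace.dual_finrank_eq (K := ℝ) (V := E)).symm.trans h)).toContinuousLinearEquiv

@[simp]
lemma flat_apply (x : M) (v : TangentSpace 𝓘(ℝ, E) x) : g.flat x v = g.val x v := rfl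

open scoped Classical in
/-- The covariant derivative `∇Y` of a vector field `Y` differentiable at `x` is determined by
the Koszul formula; at points where `Y` is not differentiable it gets the junk value `0`. -/
def covDeriv (Y : Π x : M, TangentSpace 𝓘(ℝ, E) x) (x : M) :
    TangentSpace 𝓘(ℝ, E) x →L[ℝ] TangentSpace 𝓘(ℝ, E) x :=
  if hY : MDiffAt (T% Y) x then
    (g.flat x).symm.toContinuousLinearMap ∘L
      TensorialAt.mkHom₂ (I := 𝓘(ℝ, E)) (F := E) (F' := E) (fun X Z ↦ g.koszul X Y Z x) x
        (fun _ hZ ↦ g.tensorialAt_koszul_left hY hZ)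
        (fun _ hX ↦ g.tensorialAt_koszul_right hX hY)
  else 0

/-- The Koszul formula. -/
lemma val_covDeriv (hX : MDiffAt (T% X) x) (hY : MDiffAt (T% Y) x) (hZ : MDiffAt (T% Z) x) :
    g.val x (g.covDeriv Y x (X x)) (Z x) = g.koszul X Y Z x := by
  rw [← flat_apply, covDeriv, dif_pos hY]
  simp only [ContinuousLinearMap.comp_apply, ContinuousLinearEquiv.coe_coe,
    ContinuousLinearEquiv.apply_symm_apply]
  exact TensorialAt.mkHom₂_apply _ _ hX hZ

/-- The Levi-Civita connection `∇` of `g`: `g.leviCivita Y x (X x)` is `∇_X Y` at `x`. -/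
def leviCivita : CovariantDerivative 𝓘(ℝ, E) E (TangentSpace 𝓘(ℝ, E) : M → Type _) where
  toFun := g.covDeriv
  isCovariantDerivativeOnUniv :=
    { add := fun {Y Y' x} hY hY' _ ↦ g.endo_ext fun X Z hX hZ ↦ by
        rw [g.val_covDeriv hX (mdifferentiableAt_add_section hY hY') hZ]
        simp [g.val_covDeriv hX hY hZ, g.val_covDeriv hX hY' hZ, g.koszul_add hX hY hY' hZ]
      leibniz := fun {Y f x} hY hf _ ↦ g.endo_ext fun X Z hX hZ ↦ by
        rw [g.val_covDeriv hX (hf.smul_section hY) hZ]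
        simp [g.val_covDeriv hX hY hZ, g.koszul_smul hX hY hf hZ] }

/-- The Levi-Civita connection is torsion-free. -/
lemma leviCivita_torsion : g.leviCivita.torsion = 0 := by
  rw [CovariantDerivative.torsion_eq_zero_iff]
  intro X Y x hX hY
  refine sub_eq_zero.1 (g.nondegenerate x _ fun w ↦ ?_)
  have hZ : MDiffAt (T% (FiberBundle.extend E w)) x := FiberBundle.mdifferentiableAt_extend ..
  have h1 := g.val_covDeriv hX hY hZ
  have h2 := g.val_covDeriv hY hX hZ
  simp only [FiberBundle.extend_apply_self] at h1 h2
  simp only [leviCivita, map_sub, sub_apply, h1, h2, koszul, g.pair_comm Y X,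
    mlieBracket_swap_apply (V := Y) (W := X), FiberBundle.extend_apply_self]
  simp
  ring

/-- The Lie bracket is `[X, Y]^μ = X^ν ∇_ν Y^μ - Y^ν ∇_ν X^μ`. -/
lemma mlieBracket_eq (hX : MDiffAt (T% X) x) (hY : MDiffAt (T% Y) x) :
    mlieBracket 𝓘(ℝ, E) X Y x = g.leviCivita Y x (X x) - g.leviCivita X x (Y x) :=
  (g.leviCivita.torsion_eq_zero_iff.1 g.leviCivita_torsion hX hY).symm

/-- The Levi-Civita connection is compatible with the metric. -/
lemma leviCivita_metric (hX : MDiffAt (T% X) x) (hY : MDiffAt (T% Y) x) (hZ : MDiffAt (T% Z) x) :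
    mvfderiv 𝓘(ℝ, E) (g.pair Y Z) x (X x) =
      g.val x (g.leviCivita Y x (X x)) (Z x) + g.val x (Y x) (g.leviCivita Z x (X x)) := by
  rw [g.symm x (Y x)]
  simp only [leviCivita, g.val_covDeriv hX hY hZ, g.val_covDeriv hX hZ hY, koszul,
    g.pair_comm Z Y, mlieBracket_swap_apply (V := Z) (W := Y)]
  simp
  ring

/-- `∇_μ ξ_ν + ∇_ν ξ_μ = lam g_{μν}` for a smooth vector field `ξ` and a constant `lam`. -/
structure IsHomotheticWith (lam : ℝ) (ξ : Π x : M, TangentSpace 𝓘(ℝ, E) x) : Prop where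
  contMDiff : CMDiff ∞ (T% ξ)
  symm_nabla (x : M) (u v : TangentSpace 𝓘(ℝ, E) x) :
    g.val x (g.leviCivita ξ x u) v + g.val x (g.leviCivita ξ x v) u = lam * g.val x u v

/-- Homothetic Killing vectors: the factor `lam` is a constant, possibly zero. -/
def IsHomotheticKilling (ξ : Π x : M, TangentSpace 𝓘(ℝ, E) x) : Prop :=
  ∃ lam : ℝ, g.IsHomotheticWith lam ξ

/-- (True) Killing vectors: `∇_μ ξ_ν + ∇_ν ξ_μ = 0`. -/
structure IsKilling (ξ : Π x : M, TangentSpace 𝓘(ℝ, E) x) : Prop where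
  contMDiff : CMDiff ∞ (T% ξ)
  symm_nabla (x : M) (u v : TangentSpace 𝓘(ℝ, E) x) :
    g.val x (g.leviCivita ξ x u) v + g.val x (g.leviCivita ξ x v) u = 0

/-- The real vector space of homothetic Killing vectors of `g`. -/
def homotheticKilling : Submodule ℝ (Π x : M, TangentSpace 𝓘(ℝ, E) x) where
  carrier := {ξ | g.IsHomotheticKilling ξ}
  zero_mem' := ⟨0, contMDiff_zeroSection ℝ _, fun x u v ↦ by simp⟩
  add_mem' := by
    rintro ξ η ⟨a, hξ, hξ'⟩ ⟨b, hη, hη'⟩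
    refine ⟨a + b, hξ.add_section hη, fun x u v ↦ ?_⟩
    rw [g.leviCivita.isCovariantDerivativeOnUniv.add ((hξ x).mdifferentiableAt (by simp))
      ((hη x).mdifferentiableAt (by simp))]
    have h1 := hξ' x u v
    have h2 := hη' x u v
    simp only [add_apply, map_add]
    linarith
  smul_mem' := by
    rintro c ξ ⟨a, hξ, hξ'⟩
    refine ⟨c * a, hξ.const_smul_section, fun x u v ↦ ?_⟩
    rw [g.leviCivita.isCovariantDerivativeOnUniv.smul_const c
      ((hξ x).mdifferentiableAt (by simp))]
    have h1 := hξ' x u v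
    simp only [smul_apply, map_smul, smul_eq_mul]
    linear_combination c * h1

end PseudoRiemannianMetric

end

/-! The tensor ∇_μ ξ_ν + ∇_ν ξ_μ is the Lie derivative L_ξ g (`symm_nabla_eq`). If L_ξ g = λ g and
L_η g = μ g, then L_[ξ,η] g = L_ξ L_η g − L_η L_ξ g = (μλ − λμ) g = 0. The commutator identity is
checked on g(Y, Z) for local fields Y, Z: it follows from the Jacobi identity and from [ξ,η]f = ξηf
− ηξf (`mvfderiv_mlieBracket`). For structure constants, the homothety factor is linear in the field
and unique wherever some tangent vector is nonzero. Both ∑ c λ and 0 are factors of the bracket, so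
they agree. -/

lemma ContMDiffAt.eventually_mdifferentiableAt {𝕜 : Type*} [NontriviallyNormedField 𝕜]
    {E : Type*} [NormedAddCommGroup E] [NormedSpace 𝕜 E] {H : Type*} [TopologicalSpace H]
    {I : ModelWithCorners 𝕜 E H} {M : Type*} [TopologicalSpace M] [ChartedSpace H M]
    [IsManifold I 1 M] {E' : Type*} [NormedAddCommGroup E'] [NormedSpace 𝕜 E'] {H' : Type*}
    [TopologicalSpace H'] {I' : ModelWithCorners 𝕜 E' H'} {M' : Type*} [TopologicalSpace M']
    [ChartedSpace H' M'] [IsManifold I' 1 M'] {f : M → M'} {x : M} {n : ℕ∞ω}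
    (hf : CMDiffAt n f x) (hn : 1 ≤ n) : ∀ᶠ y in nhds x, MDiffAt f y := by
  filter_upwards [(contMDiffAt_iff_contMDiffAt_nhds (by simp)).1 (hf.of_le hn)] with y hy
  exact hy.mdifferentiableAt one_ne_zero

lemma Filter.EventuallyEq.mvfderiv_eq {𝕜 : Type*} [NontriviallyNormedField 𝕜]
    {E : Type*} [NormedAddCommGroup E] [NormedSpace 𝕜 E] {H : Type*} [TopologicalSpace H]
    {I : ModelWithCorners 𝕜 E H} {M : Type*} [TopologicalSpace M] [ChartedSpace H M]
    {F : Type*} [NormedAddCommGroup F] [NormedSpace 𝕜 F] {f f' : M → F} {x : M}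
    (h : f =ᶠ[nhds x] f') : mvfderiv I f x = mvfderiv I f' x := by
  ext v
  exact congrArg (fun A : E →L[𝕜] F ↦ A v) h.mfderiv_eq

lemma mvfderiv_const_smul {E : Type*} [NormedAddCommGroup E] [NormedSpace ℝ E] {M : Type*}
    [TopologicalSpace M] [ChartedSpace E M] {f : M → ℝ} {x : M} (hf : MDiffAt f x) (c : ℝ) :
    mvfderiv 𝓘(ℝ, E) (c • f) x = c • mvfderiv 𝓘(ℝ, E) f x := by
  change mvfderiv 𝓘(ℝ, E) ((fun _ : M ↦ c) • f) x = _
  rw [mvfderiv_smul mdifferentiableAt_const hf, mvfderiv_const]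
  ext v
  simp

namespace PseudoRiemannianMetric

variable {E : Type*} [NormedAddCommGroup E] [NormedSpace ℝ E]
  {M : Type*} [TopologicalSpace M] [ChartedSpace E M] [IsManifold 𝓘(ℝ, E) ∞ M]
  (g : PseudoRiemannianMetric E M) {X Y Z ξ η : Π x : M, TangentSpace 𝓘(ℝ, E) x} {x : M}

lemma contMDiffAt_pair (hY : CMDiffAt ∞ (T% Y) x) (hZ : CMDiffAt ∞ (T% Z) x) :
    CMDiffAt ∞ (g.pair Y Z) x := by
  have : ContMDiffAt 𝓘(ℝ, E) (𝓘(ℝ, E).prod 𝓘(ℝ)) ∞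
      (fun m ↦ TotalSpace.mk' ℝ (E := Bundle.Trivial M ℝ) m (g.val m (Y m) (Z m))) x := by
    apply ContMDiffAt.clm_bundle_apply₂ (F₁ := E) (F₂ := E)
    · exact g.contMDiff x
    · exact hY
    · exact hZ
  simp only [contMDiffAt_totalSpace] at this
  exact this.2

variable [FiniteDimensional ℝ E]

/-! ### Brackets of smooth fields and their action on functions. -/

lemma _root_.ContMDiffAt.mlieBracket_smooth (hX : CMDiffAt ∞ (T% X) x)
    (hY : CMDiffAt ∞ (T% Y) x) :
    CMDiffAt ∞ (T% (mlieBracket 𝓘(ℝ, E) X Y)) x :=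
  haveI := FiniteDimensional.complete ℝ E
  haveI : IsManifold 𝓘(ℝ, E) (minSmoothness ℝ 2) M :=
    IsManifold.of_le (n := ∞) (by simpa using ENat.LEInfty.out)
  haveI : IsManifold 𝓘(ℝ, E) ((∞ : ℕ∞ω) + 1) M := ‹IsManifold 𝓘(ℝ, E) ∞ M›
  ContMDiffAt.mlieBracket_vectorField (m := ⊤) (n := ⊤) hX hY (by simp)

/-- The Jacobi identity for vector fields that are smooth at a point. -/
lemma mlieBracket_jacobi (hX : CMDiffAt ∞ (T% X) x) (hY : CMDiffAt ∞ (T% Y) x)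
    (hZ : CMDiffAt ∞ (T% Z) x) :
    mlieBracket 𝓘(ℝ, E) X (mlieBracket 𝓘(ℝ, E) Y Z) x =
      mlieBracket 𝓘(ℝ, E) (mlieBracket 𝓘(ℝ, E) X Y) Z x +
        mlieBracket 𝓘(ℝ, E) Y (mlieBracket 𝓘(ℝ, E) X Z) x := by
  have := FiniteDimensional.complete ℝ E
  have h2 : minSmoothness ℝ 2 ≤ ∞ := by simpa using ENat.LEInfty.out
  have : IsManifold 𝓘(ℝ, E) (minSmoothness ℝ 3) M :=
    IsManifold.of_le (n := ∞) (by simpa using ENat.LEInfty.out)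
  exact leibniz_identity_mlieBracket_apply (hX.of_le h2) (hY.of_le h2) (hZ.of_le h2)

/-- The Lie bracket acts on functions as the commutator of the derivations. -/
lemma mvfderiv_mlieBracket {f : M → ℝ} (hX : CMDiffAt ∞ (T% X) x) (hY : CMDiffAt ∞ (T% Y) x)
    (hf : CMDiffAt ∞ f x)
    (hXf : MDiffAt (fun y ↦ mvfderiv 𝓘(ℝ, E) f y (X y)) x)
    (hYf : MDiffAt (fun y ↦ mvfderiv 𝓘(ℝ, E) f y (Y y)) x) :
    mvfderiv 𝓘(ℝ, E) f x (mlieBracket 𝓘(ℝ, E) X Y x) =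
      mvfderiv 𝓘(ℝ, E) (fun y ↦ mvfderiv 𝓘(ℝ, E) f y (Y y)) x (X x) -
        mvfderiv 𝓘(ℝ, E) (fun y ↦ mvfderiv 𝓘(ℝ, E) f y (X y)) x (Y x) := by
  -- The Jacobi identity will give the claim multiplied by a vector v, and v ≠ 0 is needed to cancel
  -- it.
  by_cases hE : ∀ v : TangentSpace 𝓘(ℝ, E) x, v = 0
  · rw [hE (mlieBracket 𝓘(ℝ, E) X Y x), hE (X x), hE (Y x)]
    simp
  push Not at hE
  obtain ⟨v, hv⟩ := hE
  set W : Π y : M, TangentSpace 𝓘(ℝ, E) y := FiberBundle.extend E v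
  have hWx : W x = v := FiberBundle.extend_apply_self ..
  have hW : CMDiffAt ∞ (T% W) x := FiberBundle.contMDiffAt_extend ..
  -- Two Leibniz expansions of [U, [V, fW]]. The cross terms (Vf)[U,W] + (Uf)[V,W] are symmetric in
  -- U, V, so they drop out of the commutator.
  have key : ∀ {U V : Π y : M, TangentSpace 𝓘(ℝ, E) y}, CMDiffAt ∞ (T% U) x →
      CMDiffAt ∞ (T% V) x → MDiffAt (fun y ↦ mvfderiv 𝓘(ℝ, E) f y (V y)) x →
      mlieBracket 𝓘(ℝ, E) U (mlieBracket 𝓘(ℝ, E) V (f • W)) x =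
        mvfderiv 𝓘(ℝ, E) (fun y ↦ mvfderiv 𝓘(ℝ, E) f y (V y)) x (U x) • W x +
        mvfderiv 𝓘(ℝ, E) f x (V x) • mlieBracket 𝓘(ℝ, E) U W x +
        (mvfderiv 𝓘(ℝ, E) f x (U x) • mlieBracket 𝓘(ℝ, E) V W x +
        f x • mlieBracket 𝓘(ℝ, E) U (mlieBracket 𝓘(ℝ, E) V W) x) := by
    intro U V hU hV hVf
    have hf1 : MDiffAt f x := hf.mdifferentiableAt (by simp)
    have hW1 : MDiffAt (T% W) x := hW.mdifferentiableAt (by simp)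
    have hVW : MDiffAt (T% (mlieBracket 𝓘(ℝ, E) V W)) x :=
      (hV.mlieBracket_smooth hW).mdifferentiableAt (by simp)
    -- The outer bracket differentiates the inner one, so equality at x alone would not suffice.
    have hev : mlieBracket 𝓘(ℝ, E) V (f • W) =ᶠ[nhds x]
        (fun y ↦ mvfderiv 𝓘(ℝ, E) f y (V y)) • W + f • mlieBracket 𝓘(ℝ, E) V W := by
      filter_upwards [hf.eventually_mdifferentiableAt (by simp),
        hW.eventually_mdifferentiableAt (by simp)] with y hfy hWy
      exact mlieBracket_smul_right hfy hWy
    rw [Filter.EventuallyEq.rfl.mlieBracket_vectorField_eq hev,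
      mlieBracket_add_right (hVf.smul_section hW1) (hf1.smul_section hVW),
      mlieBracket_smul_right hVf hW1, mlieBracket_smul_right hf1 hVW]
  have hfW : CMDiffAt ∞ (T% (f • W)) x := hf.smul_section hW
  have hJ := mlieBracket_jacobi hX hY hfW
  rw [key hX hY hYf, key hY hX hXf, mlieBracket_smul_right (hf.mdifferentiableAt (by simp))
    (hW.mdifferentiableAt (by simp)), mlieBracket_jacobi hX hY hW, hWx] at hJ
  -- After the Jacobi identity for W itself removes the terms in f x, only multiples of W x = v
  -- remain.
  have h0 : (mvfderiv 𝓘(ℝ, E) f x (mlieBracket 𝓘(ℝ, E) X Y x) -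
      (mvfderiv 𝓘(ℝ, E) (fun y ↦ mvfderiv 𝓘(ℝ, E) f y (Y y)) x (X x) -
        mvfderiv 𝓘(ℝ, E) (fun y ↦ mvfderiv 𝓘(ℝ, E) f y (X y)) x (Y x))) • v = 0 := by
    rw [← sub_eq_zero] at hJ
    rw [← neg_eq_zero, ← hJ]
    module
  exact sub_eq_zero.1 ((smul_eq_zero.1 h0).resolve_right hv)

/-- `∇_μ ξ_ν + ∇_ν ξ_μ` is the Lie derivative of the metric along `ξ`. -/
lemma symm_nabla_eq (hξ : MDiffAt (T% ξ) x) (hY : MDiffAt (T% Y) x) (hZ : MDiffAt (T% Z) x) :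
    g.val x (g.leviCivita ξ x (Y x)) (Z x) + g.val x (g.leviCivita ξ x (Z x)) (Y x) =
      mvfderiv 𝓘(ℝ, E) (g.pair Y Z) x (ξ x) - g.pair (mlieBracket 𝓘(ℝ, E) ξ Y) Z x -
        g.pair Y (mlieBracket 𝓘(ℝ, E) ξ Z) x := by
  -- Metric compatibility expands ξ(g(Y,Z)); vanishing torsion turns ∇_ξ Y − [ξ,Y] into ∇_Y ξ, and
  -- likewise for Z.
  rw [g.leviCivita_metric hξ hY hZ, pair, pair, g.symm x (Y x) (mlieBracket 𝓘(ℝ, E) ξ Z x),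
    g.symm x (Y x), g.mlieBracket_eq hξ hY, g.mlieBracket_eq hξ hZ]
  simp only [map_sub, sub_apply]
  ring

/-! ### Brackets of homothetic fields. -/

variable {g} {lam mu : ℝ}

lemma IsHomotheticWith.mvfderiv_pair (h : g.IsHomotheticWith lam ξ)
    (hY : MDiffAt (T% Y) x) (hZ : MDiffAt (T% Z) x) :
    mvfderiv 𝓘(ℝ, E) (g.pair Y Z) x (ξ x) =
      lam * g.pair Y Z x + g.pair (mlieBracket 𝓘(ℝ, E) ξ Y) Z x +
        g.pair Y (mlieBracket 𝓘(ℝ, E) ξ Z) x := by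
  have h1 := g.symm_nabla_eq ((h.contMDiff x).mdifferentiableAt (by simp)) hY hZ
  have h2 := h.symm_nabla x (Y x) (Z x)
  simp only [pair] at *
  linarith

/-- Holding near x and not only at x, this can be differentiated along a second field. -/
lemma IsHomotheticWith.mvfderiv_pair_eventuallyEq (h : g.IsHomotheticWith lam ξ)
    (hY : CMDiffAt ∞ (T% Y) x) (hZ : CMDiffAt ∞ (T% Z) x) :
    (fun y ↦ mvfderiv 𝓘(ℝ, E) (g.pair Y Z) y (ξ y)) =ᶠ[nhds x]
      (lam • g.pair Y Z + g.pair (mlieBracket 𝓘(ℝ, E) ξ Y) Z) +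
        g.pair Y (mlieBracket 𝓘(ℝ, E) ξ Z) := by
  filter_upwards [hY.eventually_mdifferentiableAt (by simp),
    hZ.eventually_mdifferentiableAt (by simp)] with y hYy hZy
  exact h.mvfderiv_pair hYy hZy

/-- The bracket of two homothetic Killing vectors is a true Killing vector. -/
theorem IsHomotheticWith.isKilling_mlieBracket (hξ : g.IsHomotheticWith lam ξ)
    (hη : g.IsHomotheticWith mu η) : g.IsKilling (mlieBracket 𝓘(ℝ, E) ξ η) := by
  have hsm : CMDiff ∞ (T% (mlieBracket 𝓘(ℝ, E) ξ η)) := fun x ↦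
    (hξ.contMDiff x).mlieBracket_smooth (hη.contMDiff x)
  refine ⟨hsm, fun x u v ↦ ?_⟩
  have hdiff : ∀ {V : Π y : M, TangentSpace 𝓘(ℝ, E) y}, CMDiffAt ∞ (T% V) x → MDiffAt (T% V) x :=
    fun h ↦ h.mdifferentiableAt (by simp)
  set Y : Π y : M, TangentSpace 𝓘(ℝ, E) y := FiberBundle.extend E u
  set Z : Π y : M, TangentSpace 𝓘(ℝ, E) y := FiberBundle.extend E v
  have hY : CMDiffAt ∞ (T% Y) x := FiberBundle.contMDiffAt_extend ..
  have hZ : CMDiffAt ∞ (T% Z) x := FiberBundle.contMDiffAt_extend ..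
  have hYx : Y x = u := FiberBundle.extend_apply_self ..
  have hZx : Z x = v := FiberBundle.extend_apply_self ..
  rw [← hYx, ← hZx, g.symm_nabla_eq (hdiff (hsm x)) (hdiff hY) (hdiff hZ)]
  have hf := g.contMDiffAt_pair hY hZ
  -- The second derivative ξ(η(g(Y,Z))), for arbitrary homothetic fields so that it serves in both
  -- orders.
  have second : ∀ {ξ η : Π y : M, TangentSpace 𝓘(ℝ, E) y} {lam mu : ℝ},
      g.IsHomotheticWith lam ξ → g.IsHomotheticWith mu η →
      MDiffAt (fun y ↦ mvfderiv 𝓘(ℝ, E) (g.pair Y Z) y (η y)) x ∧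
      mvfderiv 𝓘(ℝ, E) (fun y ↦ mvfderiv 𝓘(ℝ, E) (g.pair Y Z) y (η y)) x (ξ x) =
        mu * mvfderiv 𝓘(ℝ, E) (g.pair Y Z) x (ξ x) +
        (lam * g.pair (mlieBracket 𝓘(ℝ, E) η Y) Z x +
          g.pair (mlieBracket 𝓘(ℝ, E) ξ (mlieBracket 𝓘(ℝ, E) η Y)) Z x +
          g.pair (mlieBracket 𝓘(ℝ, E) η Y) (mlieBracket 𝓘(ℝ, E) ξ Z) x) +
        (lam * g.pair Y (mlieBracket 𝓘(ℝ, E) η Z) x +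
          g.pair (mlieBracket 𝓘(ℝ, E) ξ Y) (mlieBracket 𝓘(ℝ, E) η Z) x +
          g.pair Y (mlieBracket 𝓘(ℝ, E) ξ (mlieBracket 𝓘(ℝ, E) η Z)) x) := by
    intro ξ η lam mu hξ hη
    have hηY := (hη.contMDiff x).mlieBracket_smooth hY
    have hηZ := (hη.contMDiff x).mlieBracket_smooth hZ
    have h0 : MDiffAt (g.pair Y Z) x := hf.mdifferentiableAt (by simp)
    have h1 := h0.const_smul mu
    have h2 := g.mdifferentiableAt_pair (hdiff hηY) (hdiff hZ)
    have h3 := g.mdifferentiableAt_pair (hdiff hY) (hdiff hηZ)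
    have hev := hη.mvfderiv_pair_eventuallyEq hY hZ
    refine ⟨((h1.add h2).add h3).congr_of_eventuallyEq hev, ?_⟩
    rw [show mvfderiv 𝓘(ℝ, E) (fun y ↦ mvfderiv 𝓘(ℝ, E) (g.pair Y Z) y (η y)) x = _ from
      hev.mvfderiv_eq, mvfderiv_add (h1.add h2) h3, mvfderiv_add h1 h2, mvfderiv_const_smul h0]
    simp only [add_apply, smul_apply, smul_eq_mul, hξ.mvfderiv_pair (hdiff hηY) (hdiff hZ),
      hξ.mvfderiv_pair (hdiff hY) (hdiff hηZ)]
  obtain ⟨hηf, e1⟩ := second hξ hη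
  obtain ⟨hξf, e2⟩ := second hη hξ
  rw [mvfderiv_mlieBracket (hξ.contMDiff x) (hη.contMDiff x) hf hξf hηf, e1, e2,
    hξ.mvfderiv_pair (hdiff hY) (hdiff hZ), hη.mvfderiv_pair (hdiff hY) (hdiff hZ)]
  -- In the difference, all terms carrying `lam` or `mu` cancel, as do the mixed terms
  -- g([η,Y],[ξ,Z]) + g([ξ,Y],[η,Z]); the Jacobi identity accounts for the double brackets.
  simp only [pair, mlieBracket_jacobi (hξ.contMDiff x) (hη.contMDiff x) hY,
    mlieBracket_jacobi (hξ.contMDiff x) (hη.contMDiff x) hZ, map_add, add_apply]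
  ring

/-! ### Linearity and uniqueness of the homothety factor. -/

lemma IsKilling.isHomotheticWith (h : g.IsKilling ξ) : g.IsHomotheticWith 0 ξ :=
  ⟨h.contMDiff, fun x u v ↦ by rw [h.symm_nabla x u v, zero_mul]⟩

lemma IsHomotheticWith.add (hξ : g.IsHomotheticWith lam ξ) (hη : g.IsHomotheticWith mu η) :
    g.IsHomotheticWith (lam + mu) (ξ + η) := by
  refine ⟨hξ.contMDiff.add_section hη.contMDiff, fun x u v ↦ ?_⟩
  rw [g.leviCivita.isCovariantDerivativeOnUniv.add
    ((hξ.contMDiff x).mdifferentiableAt (by simp)) ((hη.contMDiff x).mdifferentiableAt (by simp))]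
  have h1 := hξ.symm_nabla x u v
  have h2 := hη.symm_nabla x u v
  simp only [add_apply, map_add]
  linarith

lemma IsHomotheticWith.smul (c : ℝ) (hξ : g.IsHomotheticWith lam ξ) :
    g.IsHomotheticWith (c * lam) (c • ξ) := by
  refine ⟨hξ.contMDiff.const_smul_section, fun x u v ↦ ?_⟩
  rw [g.leviCivita.isCovariantDerivativeOnUniv.smul_const c
    ((hξ.contMDiff x).mdifferentiableAt (by simp))]
  have h1 := hξ.symm_nabla x u v
  simp only [smul_apply, map_smul, smul_eq_mul]
  linear_combination c * h1

lemma isHomotheticWith_zero : g.IsHomotheticWith 0 0 :=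
  ⟨contMDiff_zeroSection ℝ _, fun x u v ↦ by simp⟩

/-- Makes ∑ c λ a homothety factor of the bracket expanded in a basis. -/
lemma isHomotheticWith_finsuppSum {ι : Type*} {ξ : ι → Π x : M, TangentSpace 𝓘(ℝ, E) x}
    {lam : ι → ℝ} (h : ∀ k, g.IsHomotheticWith (lam k) (ξ k)) (c : ι →₀ ℝ) :
    g.IsHomotheticWith (c.sum fun k a ↦ a * lam k) (c.sum fun k a ↦ a • ξ k) := by
  classical
  simp only [Finsupp.sum]
  induction c.support using Finset.induction_on with
  | empty => simpa using isHomotheticWith_zero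
  | insert k s hk ih =>
    rw [Finset.sum_insert hk, Finset.sum_insert hk]
    exact ((h k).smul _).add ih

/-- The homothety factor is unique unless all tangent vectors vanish. -/
lemma IsHomotheticWith.unique (h : g.IsHomotheticWith lam ξ) (h' : g.IsHomotheticWith mu ξ)
    {u : TangentSpace 𝓘(ℝ, E) x} (hu : u ≠ 0) : lam = mu := by
  by_contra hne
  refine hu (g.nondegenerate x u fun w ↦ ?_)
  have := (h.symm_nabla x u w).symm.trans (h'.symm_nabla x u w)
  exact (mul_eq_mul_right_iff.1 this).resolve_left hne

lemma coe_linearCombination {ι : Type*} (b : ι → g.homotheticKilling) (c : ι →₀ ℝ) :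
    (Finsupp.linearCombination ℝ b c).1 = c.sum fun k a ↦ a • (b k).1 := by
  simp [Finsupp.linearCombination_apply, Finsupp.sum]

end PseudoRiemannianMetric

open PseudoRiemannianMetric in
theorem mainTheorem4 {E : Type*} [NormedAddCommGroup E] [NormedSpace ℝ E] [FiniteDimensional ℝ E]
    {M : Type*} [TopologicalSpace M] [ChartedSpace E M] [IsManifold 𝓘(ℝ, E) ∞ M]
    (g : PseudoRiemannianMetric E M) :
    (∀ ξ η : Π x : M, TangentSpace 𝓘(ℝ, E) x,
      g.IsHomotheticKilling ξ → g.IsHomotheticKilling η →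
        g.IsKilling (mlieBracket 𝓘(ℝ, E) ξ η)) ∧
    (∀ {ι : Type*} (b : Module.Basis ι ℝ g.homotheticKilling),
      -- existence and uniqueness of the structure constants `c i j k` of the basis `b`
      (∃! c : ι → ι → ι →₀ ℝ, ∀ i j : ι,
        mlieBracket 𝓘(ℝ, E) (b i).1 (b j).1 = (c i j).sum fun k a ↦ a • (b k).1) ∧
      ∀ lam : ι → ℝ, (∀ k, g.IsHomotheticWith (lam k) (b k).1) →
        ∀ c : ι → ι → ι →₀ ℝ,
          (∀ i j : ι,
            mlieBracket 𝓘(ℝ, E) (b i).1 (b j).1 = (c i j).sum fun k a ↦ a • (b k).1) →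
          ∀ i j : ι, ((c i j).sum fun k a ↦ a * lam k) = 0) := by
  have bracket : ∀ ξ η : Π x : M, TangentSpace 𝓘(ℝ, E) x,
      g.IsHomotheticKilling ξ → g.IsHomotheticKilling η →
        g.IsKilling (mlieBracket 𝓘(ℝ, E) ξ η) := fun _ _ ⟨_, hξ⟩ ⟨_, hη⟩ ↦
    hξ.isKilling_mlieBracket hη
  refine ⟨bracket, fun {ι} b ↦ ⟨?_, fun lam hlam c hc i j ↦ ?_⟩⟩
  · let B (i j : ι) : g.homotheticKilling := ⟨mlieBracket 𝓘(ℝ, E) (b i).1 (b j).1,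
      0, (bracket _ _ (b i).2 (b j).2).isHomotheticWith⟩
    refine ⟨fun i j ↦ b.repr (B i j), fun i j ↦ ?_, fun c hc ↦ ?_⟩
    · rw [← coe_linearCombination, b.linearCombination_repr]
    · funext i j
      have h : B i j = Finsupp.linearCombination ℝ b (c i j) :=
        Subtype.ext ((hc i j).trans (coe_linearCombination _ _).symm)
      rw [h, b.repr_linearCombination]
  -- A basis vector is a nonzero field, which supplies the nonzero tangent vector that uniqueness of
  -- the factor requires.
  · obtain ⟨x, hx⟩ : ∃ x, (b i).1 x ≠ 0 := by
      by_contra! h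
      exact b.ne_zero i (Subtype.ext (funext h))
    refine (isHomotheticWith_finsuppSum hlam (c i j)).unique (x := x) ?_ hx
    rw [← hc i j]
    exact (bracket _ _ (b i).2 (b j).2).isHomotheticWith
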